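/- Let the Farey graph $\mathcal F$ be the graph with vertex set $\mathbb{Q}\cup\{\infty\}$ in which two vertices are joined by an edge iff they can be written as $p/q$ and $r/s$ (with $\infty=1/0$) with $p,q,r,s\in\mathbb Z$ and $|ps-qr|=1$; let $d$ be its path metric. $\mathrm{PSL}(2,\mathbb Z)$ acts on $\mathcal F$ by Möbius transformations. For $f\in \mathrm{PSL}(2,\mathbb Z)$ let $l(f)=\liminf_{j\to\infty} d(\alpha,f^j(\alpha))/j$ be its (stable) translation length on $\mathcal F$, where $\alpha$ is any vertex (the value does not depend on $\alpha$). Call $f$ hyperbolic if $|\mathrm{tr} f|>2$, and let its dilatation $\lambda(f)>1$ be the largest absolute value of an eigenvalue of a matrix representing $f$. Write $[f]$ for the conjugacy class of $f$ in $\mathrm{PSL}(2,\mathbb Z)$. For hyperbolic $f$ and $R\in\mathbb R$ put $$m_f=\#\{[f'] : f' \text{ hyperbolic},\ l(f')=l(f)\},\qquad m_f(R)=\#\{[f'] : f' \text{ hyperbolic},\ \lambda(f')<R,\ l(f')=l(f)\},$$ which are elements of $\{0,1,2,\dots\}\cup\{\infty\}$. Theorem. For every positive integer $k$: the set $\{[f]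 : f \text{ hyperbolic},\ \lambda(f)<R\}$ is finite for every real $R$, and $$\lim_{R\to\infty}\frac{\#\{[f] : f\text{ hyperbolic},\ \lambda(f)<R,\ m_f\ge k\}}{\#\{[f] : f\text{ hyperbolic},\ \lambda(f)<R\}}=1, \qquad \lim_{R\to\infty}\frac{\#\{[f] : f\text{ hyperbolic},\ \lambda(f)<R,\ m_f(R)\ge k\}}{\#\{[f] : f\text{ hyperbolic},\ \lambda(f)<R\}}=1.$$ -/

import Mathlib

open Filter Topology
open scoped MatrixGroups ENNReal OnePoint

/-- The extended rational number `p / q`, with `p / 0 = ∞` (used only for `(p, q) ≠ (0, 0)`). -/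
def extRat (p q : ℤ) : OnePoint ℚ :=
  if q = 0 then ∞ else (((p : ℚ) / (q : ℚ) : ℚ) : OnePoint ℚ)

theorem extRat_det_eq_zero {p q r s : ℤ} (h : extRat p q = extRat r s) :
    p * s - q * r = 0 := by
  unfold extRat at h
  by_cases hq : q = 0 <;> by_cases hs : s = 0
  · simp [hq, hs]
  · simp [hq, hs] at h
  · simp [hq, hs] at h
  · rw [if_neg hq, if_neg hs, OnePoint.coe_eq_coe,
      div_eq_div_iff (by exact_mod_cast hq) (by exact_mod_cast hs)] at h
    have h' : p * s = r * q := by exact_mod_cast h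
    rw [h']; ring

/-- The **Farey graph**: its vertices are the extended rationals, and two vertices are adjacent
when they can be written `p / q` and `r / s` with `|p s - q r| = 1`. -/
def fareyGraph : SimpleGraph (OnePoint ℚ) where
  Adj x y := ∃ p q r s : ℤ, x = extRat p q ∧ y = extRat r s ∧ |p * s - q * r| = 1
  symm := ⟨by
    rintro x y ⟨p, q, r, s, hx, hy, h⟩
    refine ⟨r, s, p, q, hy, hx, ?_⟩
    rw [← h, ← abs_neg]
    congr 1
    ring⟩
  loopless := ⟨by
    rintro x ⟨p, q, r, s, hx, hy, h⟩
    have h0 : p * s - q * r = 0 := extRat_det_eq_zero (hx.symm.trans hy)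
    simp [h0] at h⟩

/-- The action of `SL(2, ℤ)` on the extended rationals by Möbius transformations
`x ↦ (a x + b) / (c x + d)`. -/
noncomputable def mobiusSL : SL(2, ℤ) →* Equiv.Perm (OnePoint ℚ) :=
  (MulAction.toPermHom (GL (Fin 2) ℚ) (OnePoint ℚ)).comp (Matrix.SpecialLinearGroup.mapGL ℚ)

theorem eq_or_eq_neg_of_mem_center {A : SL(2, ℤ)} (hA : A ∈ Subgroup.center SL(2, ℤ)) :
    A = 1 ∨ A = -1 := by
  obtain ⟨r, hr, h⟩ := Matrix.SpecialLinearGroup.mem_center_iff.mp hA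
  rw [Fintype.card_fin, sq_eq_one_iff] at hr
  rcases hr with rfl | rfl
  · left
    apply Subtype.ext
    rw [← h]
    simp
  · right
    apply Subtype.ext
    rw [← h]
    ext i j
    fin_cases i <;> fin_cases j <;> simp [Matrix.scalar]

theorem mobiusSL_neg_one : mobiusSL (-1) = 1 := by
  ext1 x
  change Matrix.SpecialLinearGroup.mapGL ℚ (-1 : SL(2, ℤ)) • x = x
  cases x with
  | infty => simp [OnePoint.smul_infty_eq_ite]
  | coe c => simp [OnePoint.smul_some_eq_ite]

/-- The induced action of `PSL(2, ℤ)` on the vertices of the Farey graph. -/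
noncomputable def mobius : PSL(2, ℤ) →* Equiv.Perm (OnePoint ℚ) :=
  QuotientGroup.lift (Subgroup.center SL(2, ℤ)) mobiusSL (by
    intro A hA
    rcases eq_or_eq_neg_of_mem_center hA with rfl | rfl
    · simp
    · exact mobiusSL_neg_one)

theorem eq_or_eq_neg_of_leftRel {A B : SL(2, ℤ)}
    (h : QuotientGroup.leftRel (Subgroup.center SL(2, ℤ)) A B) : B = A ∨ B = -A := by
  rw [QuotientGroup.leftRel_apply] at h
  rcases eq_or_eq_neg_of_mem_center h with h | h
  · left
    exact (inv_mul_eq_one.mp h).symm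
  · right
    rw [inv_mul_eq_iff_eq_mul.mp h]
    simp

/-- The trace of an element of `PSL(2, ℤ)`: the absolute value of the trace of a matrix
representing it. -/
def absTrace : PSL(2, ℤ) → ℤ :=
  Quotient.lift (fun A : SL(2, ℤ) ↦ |(A : Matrix (Fin 2) (Fin 2) ℤ).trace|) (by
    intro A B h
    rcases eq_or_eq_neg_of_leftRel h with rfl | rfl
    · rfl
    · simp [Matrix.trace_neg])

/-- An element of `PSL(2, ℤ)` is hyperbolic (an Anosov map of the torus) if its trace exceeds
`2` in absolute value. -/
def IsHyperbolicPSL (f : PSL(2, ℤ)) : Prop := 2 < absTrace f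

/-- The **dilatation** of an element of `PSL(2, ℤ)`: the largest absolute value of a (complex)
eigenvalue of a matrix representing it. For hyperbolic elements this is the number `λ > 1` such
that `λ` or `-λ` is the leading eigenvalue. -/
noncomputable def dilatation : PSL(2, ℤ) → ℝ :=
  Quotient.lift (fun A : SL(2, ℤ) ↦ (spectralRadius ℂ
    ((A : Matrix (Fin 2) (Fin 2) ℤ).map (Int.cast : ℤ → ℂ))).toReal) (by
    intro A B h
    rcases eq_or_eq_neg_of_leftRel h with rfl | rfl
    · rfl
    · have h1 : ((-A : SL(2, ℤ)) : Matrix (Fin 2) (Fin 2) ℤ).map (Int.cast : ℤ → ℂ)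
          = -((A : Matrix (Fin 2) (Fin 2) ℤ).map (Int.cast : ℤ → ℂ)) := by
        ext i j
        simp
      simp only [h1, spectralRadius, ← spectrum.neg_eq]
      congr 1
      apply le_antisymm
      · refine iSup₂_le fun μ hμ ↦ ?_
        exact le_iSup₂_of_le (-μ) (by simpa using hμ) (by simp)
      · refine iSup₂_le fun μ hμ ↦ ?_
        exact le_iSup₂_of_le (-μ) (by simpa using hμ) (by simp))

/-- `liminf_j d(α, f ^ j α) / j`, where `d` is the path metric of the Farey graph. -/
noncomputable def stableLengthAt (f : PSL(2, ℤ)) (α : OnePoint ℚ) : ℝ≥0∞ :=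
  liminf (fun j : ℕ ↦ (fareyGraph.edist α (mobius (f ^ j) α) : ℝ≥0∞) / (j : ℝ≥0∞)) atTop

/-- The (stable) translation length of `f` on the Farey graph. It does not depend on the chosen
base vertex, see `stableLengthAt_eq_translationLength`. -/
noncomputable def translationLength (f : PSL(2, ℤ)) : ℝ≥0∞ := stableLengthAt f ∞

theorem extRat_smul (A : SL(2, ℤ)) {p q : ℤ} (h : p ≠ 0 ∨ q ≠ 0) :
    mobiusSL A (extRat p q) = extRat (A 0 0 * p + A 0 1 * q) (A 1 0 * p + A 1 1 * q) := by
  change Matrix.SpecialLinearGroup.mapGL ℚ A • extRat p q = _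
  unfold extRat
  by_cases hq : q = 0
  · have hp : p ≠ 0 := by simpa [hq] using h
    have hp' : (p : ℚ) ≠ 0 := by exact_mod_cast hp
    subst hq
    simp only [if_true, OnePoint.smul_infty_eq_ite]
    by_cases hc : A 1 0 = 0
    · simp [hc]
    · have hc' : (A 1 0 : ℚ) ≠ 0 := by exact_mod_cast hc
      simp [hc, hp]
      field_simp
  · have hq' : (q : ℚ) ≠ 0 := by exact_mod_cast hq
    simp only [if_neg hq, OnePoint.smul_some_eq_ite]
    have key : ((A 1 0 : ℚ) * (p / q) + A 1 1 = 0) ↔ (A 1 0 * p + A 1 1 * q = 0) := by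
      rw [← @Int.cast_inj ℚ]
      push_cast
      rw [← mul_left_inj' hq']
      field_simp
      simp
    by_cases hc : A 1 0 * p + A 1 1 * q = 0
    · simp [hc, key.mpr hc]
    · have h1 := mt key.mp hc
      have h2 : (A 1 0 : ℚ) * p + A 1 1 * q ≠ 0 := by exact_mod_cast hc
      simp [hc, h1]
      field_simp

theorem fareyGraph_adj_mobiusSL (A : SL(2, ℤ)) {x y : OnePoint ℚ} (h : fareyGraph.Adj x y) :
    fareyGraph.Adj (mobiusSL A x) (mobiusSL A y) := by
  obtain ⟨p, q, r, s, rfl, rfl, h⟩ := h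
  have h1 : p ≠ 0 ∨ q ≠ 0 := by
    by_contra hc
    push Not at hc
    simp [hc.1, hc.2] at h
  have h2 : r ≠ 0 ∨ s ≠ 0 := by
    by_contra hc
    push Not at hc
    simp [hc.1, hc.2] at h
  refine ⟨_, _, _, _, extRat_smul A h1, extRat_smul A h2, ?_⟩
  have hd : A 0 0 * A 1 1 - A 0 1 * A 1 0 = 1 := by
    have := A.det_coe
    rwa [Matrix.det_fin_two] at this
  refine Eq.trans (congrArg _ ?_) h
  linear_combination (p * s - q * r) * hd

/-- `PSL(2, ℤ)` acts on the Farey graph by isometries. -/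
theorem edist_mobius (f : PSL(2, ℤ)) (x y : OnePoint ℚ) :
    fareyGraph.edist (mobius f x) (mobius f y) = fareyGraph.edist x y := by
  have hle : ∀ (A : SL(2, ℤ)) (x y : OnePoint ℚ),
      fareyGraph.edist (mobiusSL A x) (mobiusSL A y) ≤ fareyGraph.edist x y := by
    intro A x y
    let φ : fareyGraph →g fareyGraph := ⟨mobiusSL A, fun h ↦ fareyGraph_adj_mobiusSL A h⟩
    refine le_iInf fun w ↦ ?_
    have := SimpleGraph.edist_le (w.map φ)
    rwa [SimpleGraph.Walk.length_map] at this
  obtain ⟨A, rfl⟩ := QuotientGroup.mk_surjective f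
  change fareyGraph.edist (mobiusSL A x) (mobiusSL A y) = _
  refine le_antisymm (hle A x y) ?_
  have := hle A⁻¹ (mobiusSL A x) (mobiusSL A y)
  simpa [← Equiv.Perm.mul_apply, ← map_mul] using this

theorem fareyGraph_reachable_infty (x : OnePoint ℚ) : fareyGraph.Reachable ∞ x := by
  have hS : ∀ A ∈ Subgroup.closure {ModularGroup.S, ModularGroup.T},
      fareyGraph.Reachable ∞ (mobiusSL A ∞) := by
    have hmap : ∀ (A : SL(2, ℤ)) (x y : OnePoint ℚ), fareyGraph.Reachable x y →
        fareyGraph.Reachable (mobiusSL A x) (mobiusSL A y) := by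
      intro A x y h
      let φ : fareyGraph →g fareyGraph := ⟨mobiusSL A, fun h ↦ fareyGraph_adj_mobiusSL A h⟩
      exact h.map φ
    have hinf : (∞ : OnePoint ℚ) = extRat 1 0 := by simp [extRat]
    intro A hA
    induction hA using Subgroup.closure_induction with
    | mem A hA =>
      rcases hA with rfl | rfl
      · refine SimpleGraph.Adj.reachable ⟨1, 0, 0, 1, hinf, ?_, by simp⟩
        rw [hinf, extRat_smul _ (by simp)]
        simp [ModularGroup.S]
      · rw [hinf, extRat_smul _ (by simp)]
        simp [ModularGroup.T]
    | one => simp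
    | mul A B _ _ ihA ihB =>
      rw [map_mul, Equiv.Perm.mul_apply]
      exact ihA.trans (hmap A _ _ ihB)
    | inv A _ ih =>
      have := hmap A⁻¹ _ _ ih
      rw [← Equiv.Perm.mul_apply, ← map_mul] at this
      simpa using this.symm
  obtain ⟨A, rfl⟩ := x.exists_mem_SL2 ℤ
  exact hS A (by rw [SpecialLinearGroup.SL2Z_generators]; trivial)

/-- The stable translation length does not depend on the base vertex. -/
theorem stableLengthAt_eq_translationLength (f : PSL(2, ℤ)) (α : OnePoint ℚ) :
    stableLengthAt f α = translationLength f := by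
  have hle : ∀ α β : OnePoint ℚ, stableLengthAt f α ≤ stableLengthAt f β := by
    intro α β
    have hfin : fareyGraph.edist α β ≠ ⊤ := SimpleGraph.edist_ne_top_iff_reachable.mpr
      ((fareyGraph_reachable_infty α).symm.trans (fareyGraph_reachable_infty β))
    have hC : (2 * (fareyGraph.edist α β : ℝ≥0∞)) ≠ ⊤ :=
      ENNReal.mul_ne_top (by simp) (by simpa using hfin)
    have ht : Tendsto (fun j : ℕ ↦ (2 * (fareyGraph.edist α β : ℝ≥0∞)) / (j : ℝ≥0∞))
        atTop (𝓝 0) := by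
      simpa using ENNReal.Tendsto.const_div (a := 2 * (fareyGraph.edist α β : ℝ≥0∞))
        ENNReal.tendsto_nat_nhds_top (Or.inr hC)
    unfold stableLengthAt
    rw [← ENNReal.liminf_add_of_left_tendsto_zero ht
      (fun j : ℕ ↦ (fareyGraph.edist β (mobius (f ^ j) β) : ℝ≥0∞) / (j : ℝ≥0∞))]
    refine liminf_le_liminf (Eventually.of_forall fun j ↦ ?_)
    simp only [Pi.add_apply]
    rw [← ENNReal.add_div]
    refine ENNReal.div_le_div_right ?_ _
    have h1 : fareyGraph.edist α (mobius (f ^ j) α) ≤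
        2 * fareyGraph.edist α β + fareyGraph.edist β (mobius (f ^ j) β) := by
      calc fareyGraph.edist α (mobius (f ^ j) α)
          ≤ fareyGraph.edist α β + fareyGraph.edist β (mobius (f ^ j) α) :=
            SimpleGraph.edist_triangle
        _ ≤ fareyGraph.edist α β + (fareyGraph.edist β (mobius (f ^ j) β) +
            fareyGraph.edist (mobius (f ^ j) β) (mobius (f ^ j) α)) := by
            gcongr
            exact SimpleGraph.edist_triangle
        _ = 2 * fareyGraph.edist α β + fareyGraph.edist β (mobius (f ^ j) β) := by
            rw [edist_mobius, SimpleGraph.edist_comm (u := β) (v := α)]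
            ring
    exact_mod_cast h1
  exact le_antisymm (hle _ _) (hle _ _)

/-- The set of conjugacy classes `[f]` of hyperbolic elements of `PSL(2, ℤ)` with
`dilatation f < R`. -/
def hyperbolicClasses (R : ℝ) : Set (ConjClasses PSL(2, ℤ)) :=
  {c | ∃ f : PSL(2, ℤ), c = ConjClasses.mk f ∧ IsHyperbolicPSL f ∧ dilatation f < R}

/-- The number `m_f ∈ ℕ ∪ {∞}` of all conjugacy classes `[f']` of hyperbolic elements with the
same translation length as `f`. -/
noncomputable def sameLengthCount (f : PSL(2, ℤ)) : ℕ∞ :=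
  Set.encard {c : ConjClasses PSL(2, ℤ) | ∃ f' : PSL(2, ℤ), c = ConjClasses.mk f' ∧
    IsHyperbolicPSL f' ∧ translationLength f' = translationLength f}

/-- The number of those conjugacy classes `[f']` of hyperbolic elements with the same translation
length as `f` whose dilatation is less than `R`. -/
noncomputable def sameLengthCountBelow (R : ℝ) (f : PSL(2, ℤ)) : ℕ∞ :=
  Set.encard {c : ConjClasses PSL(2, ℤ) | ∃ f' : PSL(2, ℤ), c = ConjClasses.mk f' ∧
    IsHyperbolicPSL f' ∧ dilatation f' < R ∧ translationLength f' = translationLength f}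

/-! The proof is a pigeonhole argument: there are at least `R - 4` classes below `R`, but only
`O(log R ^ 4)` translation lengths for them. A hyperbolic class contains a matrix `B` with
nonnegative entries bounded by the squared trace (`exists_conj_entries_nonneg`). The edge `{0, ∞}`
separates the Farey graph, and so do its translates by powers of `B`, which occur in order. Every
path therefore decomposes along them, and the translation length depends only on the four distances
between the ends of `{0, ∞}` and those of its image (`translationLength_eq_liminf`). By the
Euclidean algorithm these distances are `O(log R)`, which bounds the number of lengths. Classes with
fewer than `k` companions below `R` number at most `k` per length, hence `O(k log R ^ 4)`, a
vanishing proportion. -/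

/-! ### Conjugation to a nonnegative matrix -/

theorem SL2_det_entries (A : SL(2, ℤ)) : A 0 0 * A 1 1 - A 0 1 * A 1 0 = 1 := by
  have := A.det_coe
  rwa [Matrix.det_fin_two] at this

theorem SL2_conj_coe (A h : SL(2, ℤ)) {p q r s : ℤ}
    (hh : (h : Matrix (Fin 2) (Fin 2) ℤ) = !![p, q; r, s]) :
    ((h * A * h⁻¹ : SL(2, ℤ)) : Matrix (Fin 2) (Fin 2) ℤ) =
    !![(p * A 0 0 + q * A 1 0) * s - (p * A 0 1 + q * A 1 1) * r,
      (p * A 0 1 + q * A 1 1) * p - (p * A 0 0 + q * A 1 0) * q;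
      (r * A 0 0 + s * A 1 0) * s - (r * A 0 1 + s * A 1 1) * r,
      (r * A 0 1 + s * A 1 1) * p - (r * A 0 0 + s * A 1 0) * q] := by
  rw [Matrix.SpecialLinearGroup.coe_mul, Matrix.SpecialLinearGroup.coe_mul,
    Matrix.SpecialLinearGroup.coe_inv, Matrix.adjugate_fin_two, hh]
  ext i j
  fin_cases i <;> fin_cases j <;>
    simp [Matrix.mul_apply, Matrix.vecMul, dotProduct, Fin.sum_univ_two] <;> ring

/-- Descent on `|b| + |c|`. If `b c < 0`, then `(a - d)² + 4 b c = t² - 4 > 0` for the trace `t`, so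
`|a - d|` exceeds `2|b|` or `2|c|`; a unipotent conjugation of the right sign then makes the other
off-diagonal entry smaller in absolute value or carries it to zero or across it. -/
theorem exists_conj_offDiag_mul_nonneg (n : ℕ) (A : SL(2, ℤ))
    (hn : (A 0 1).natAbs + (A 1 0).natAbs ≤ n) (ht : 2 < A 0 0 + A 1 1) :
    ∃ g : SL(2, ℤ), 0 ≤ (g * A * g⁻¹) 0 1 * (g * A * g⁻¹) 1 0 := by
  induction n generalizing A with
  | zero =>
    refine ⟨1, ?_⟩
    have h : A 0 1 = 0 := by omega
    simp [h]
  | succ n ih =>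
    by_cases hbc : 0 ≤ A 0 1 * A 1 0
    · exact ⟨1, by simpa using hbc⟩
    push Not at hbc
    have hdet := SL2_det_entries A
    have step : ∀ h B : SL(2, ℤ), B = h * A * h⁻¹ → 2 < B 0 0 + B 1 1 →
        (0 ≤ B 0 1 * B 1 0 ∨ (B 0 1).natAbs + (B 1 0).natAbs ≤ n) →
        ∃ g : SL(2, ℤ), 0 ≤ (g * A * g⁻¹) 0 1 * (g * A * g⁻¹) 1 0 := by
      rintro h B rfl htB (h1 | h1)
      · exact ⟨h, h1⟩
      · obtain ⟨g, hg⟩ := ih _ h1 htB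
        refine ⟨g * h, ?_⟩
        have : g * h * A * (g * h)⁻¹ = g * (h * A * h⁻¹) * g⁻¹ := by group
        rwa [this]
    -- conjugation by an upper or lower unipotent matrix
    have upper : ∀ e : ℤ, e = 1 ∨ e = -1 →
        (0 ≤ (A 0 1 + e * (A 1 1 - A 0 0) - A 1 0) * A 1 0 ∨
          (A 0 1 + e * (A 1 1 - A 0 0) - A 1 0).natAbs + (A 1 0).natAbs ≤ n) →
        ∃ g : SL(2, ℤ), 0 ≤ (g * A * g⁻¹) 0 1 * (g * A * g⁻¹) 1 0 := by
      intro e he hh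
      have he2 : e * e = 1 := by rcases he with rfl | rfl <;> norm_num
      let h : SL(2, ℤ) := ⟨!![1, e; 0, 1], by simp⟩
      have hconj := SL2_conj_coe A h rfl
      have e00 : (h * A * h⁻¹) 0 0 = A 0 0 + e * A 1 0 := by
        rw [hconj]
        simp
      have e01 : (h * A * h⁻¹) 0 1 = A 0 1 + e * (A 1 1 - A 0 0) - A 1 0 := by
        rw [hconj]
        simp
        linear_combination (-A 1 0) * he2
      have e10 : (h * A * h⁻¹) 1 0 = A 1 0 := by
        rw [hconj]
        simp
      have e11 : (h * A * h⁻¹) 1 1 = A 1 1 - e * A 1 0 := by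
        rw [hconj]
        simp
        ring
      refine step h _ rfl ?_ ?_
      · rw [e00, e11]; linarith
      · rw [e01, e10]; exact hh
    have lower : ∀ e : ℤ, e = 1 ∨ e = -1 →
        (0 ≤ A 0 1 * (A 1 0 + e * (A 0 0 - A 1 1) - A 0 1) ∨
          (A 0 1).natAbs + (A 1 0 + e * (A 0 0 - A 1 1) - A 0 1).natAbs ≤ n) →
        ∃ g : SL(2, ℤ), 0 ≤ (g * A * g⁻¹) 0 1 * (g * A * g⁻¹) 1 0 := by
      intro e he hh
      have he2 : e * e = 1 := by rcases he with rfl | rfl <;> norm_num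
      let h : SL(2, ℤ) := ⟨!![1, 0; e, 1], by simp⟩
      have hconj := SL2_conj_coe A h rfl
      have e00 : (h * A * h⁻¹) 0 0 = A 0 0 - e * A 0 1 := by
        rw [hconj]
        simp
        ring
      have e01 : (h * A * h⁻¹) 0 1 = A 0 1 := by
        rw [hconj]
        simp
      have e10 : (h * A * h⁻¹) 1 0 = A 1 0 + e * (A 0 0 - A 1 1) - A 0 1 := by
        rw [hconj]
        simp
        linear_combination (-A 0 1) * he2
      have e11 : (h * A * h⁻¹) 1 1 = A 1 1 + e * A 0 1 := by
        rw [hconj]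
        simp
        ring
      refine step h _ rfl ?_ ?_
      · rw [e00, e11]; linarith
      · rw [e01, e10]; exact hh
    generalize A 0 0 = a at *
    generalize A 0 1 = b at *
    generalize A 1 0 = c at *
    generalize A 1 1 = d at *
    have hdisc : (a - d) ^ 2 > 4 * (-(b * c)) := by nlinarith
    have habs : |a - d| > 2 * |b| ∨ |a - d| > 2 * |c| := by
      by_contra hcon
      push Not at hcon
      have h1 : |a - d| * |a - d| ≤ (2 * |b|) * (2 * |c|) :=
        mul_le_mul hcon.1 hcon.2 (abs_nonneg _) (by positivity)
      rw [abs_mul_abs_self] at h1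
      have h2 : |b| * |c| = -(b * c) := by rw [← abs_mul, abs_of_neg hbc]
      nlinarith
    have hb : b ≠ 0 := by rintro rfl; simp at hbc
    have hc : c ≠ 0 := by rintro rfl; simp at hbc
    -- The sign `e` is chosen so that `e * z` has the sign of `x`, opposite to `y`; since `|z| >
    -- |x|`, adding `e * z - x` moves `y` towards zero or past it.
    have fin : ∀ x y z : ℤ, x * y < 0 → |z| > 2 * |x| → ∃ e : ℤ, (e = 1 ∨ e = -1) ∧
        (0 ≤ (y + e * z - x) * x ∨ (y + e * z - x).natAbs < y.natAbs) := by
      intro x y z hxy hz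
      rcases mul_neg_iff.mp hxy with ⟨hx, hy⟩ | ⟨hx, hy⟩
      · rw [abs_of_pos hx] at hz
        rcases abs_cases z with ⟨h1, _⟩ | ⟨h1, _⟩
        · refine ⟨1, Or.inl rfl, ?_⟩
          by_cases h : 0 ≤ y + 1 * z - x
          · left; positivity
          · right; omega
        · refine ⟨-1, Or.inr rfl, ?_⟩
          by_cases h : 0 ≤ y + -1 * z - x
          · left; positivity
          · right; omega
      · rw [abs_of_neg hx] at hz
        rcases abs_cases z with ⟨h1, _⟩ | ⟨h1, _⟩
        · refine ⟨-1, Or.inr rfl, ?_⟩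
          by_cases h : y + -1 * z - x ≤ 0
          · left; exact mul_nonneg_of_nonpos_of_nonpos h hx.le
          · right; omega
        · refine ⟨1, Or.inl rfl, ?_⟩
          by_cases h : y + 1 * z - x ≤ 0
          · left; exact mul_nonneg_of_nonpos_of_nonpos h hx.le
          · right; omega
    rcases habs with h | h
    · obtain ⟨e, he, h1⟩ := fin b c (a - d) hbc h
      refine lower e he ?_
      rcases h1 with h1 | h1
      · left; linarith
      · right; omega
    · rw [abs_sub_comm] at h
      obtain ⟨e, he, h1⟩ := fin c b (d - a) (by linarith) h
      refine upper e he ?_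
      rcases h1 with h1 | h1
      · left; exact h1
      · right; omega

theorem SL2_trace_conj (A g : SL(2, ℤ)) :
    (g * A * g⁻¹) 0 0 + (g * A * g⁻¹) 1 1 = A 0 0 + A 1 1 := by
  have := Matrix.trace_mul_cycle (g : Matrix (Fin 2) (Fin 2) ℤ)
    (A : Matrix (Fin 2) (Fin 2) ℤ) ((g⁻¹ : SL(2, ℤ)) : Matrix (Fin 2) (Fin 2) ℤ)
  rw [← Matrix.SpecialLinearGroup.coe_mul g⁻¹ g, inv_mul_cancel,
    ← Matrix.SpecialLinearGroup.coe_mul, ← Matrix.SpecialLinearGroup.coe_mul] at this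
  simpa [Matrix.trace_fin_two] using this

/-- A hyperbolic matrix of positive trace is conjugate to one whose entries are nonnegative and
bounded by the square of the trace. -/
theorem exists_conj_entries_nonneg (A : SL(2, ℤ)) (ht : 2 < A 0 0 + A 1 1) :
    ∃ g : SL(2, ℤ), ∀ i j, 0 ≤ (g * A * g⁻¹) i j ∧
      (g * A * g⁻¹) i j ≤ (A 0 0 + A 1 1) ^ 2 := by
  obtain ⟨g, hg⟩ := exists_conj_offDiag_mul_nonneg _ A le_rfl ht
  have htr := SL2_trace_conj A
  have key : ∀ a b c d : ℤ, a * d - b * c = 1 → 0 ≤ b * c → 2 < a + d →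
      0 < a ∧ 0 < d ∧ 0 < b * c ∧ a ≤ (a + d) ^ 2 ∧ d ≤ (a + d) ^ 2 ∧ b * c ≤ (a + d) ^ 2 := by
    intro a b c d h1 h2 h3
    have had : 0 < a * d := by linarith
    rcases pos_and_pos_or_neg_and_neg_of_mul_pos had with ⟨ha, hd⟩ | ⟨ha, hd⟩
    · refine ⟨ha, hd, ?_, by nlinarith, by nlinarith, by nlinarith⟩
      -- `b c = 0` would force `a = d = ±1`, against a trace above `2`.
      rcases h2.eq_or_lt with h | h
      · rw [← h, sub_zero] at h1
        have := Int.eq_one_or_neg_one_of_mul_eq_one h1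
        have := Int.eq_one_or_neg_one_of_mul_eq_one' h1
        omega
      · exact h
    · omega
  obtain ⟨ha, hd, hbc, ha', hd', hbc'⟩ := key _ _ _ _ (SL2_det_entries (g * A * g⁻¹)) hg
    (by rw [htr]; exact ht)
  rw [htr] at ha' hd' hbc'
  rcases pos_and_pos_or_neg_and_neg_of_mul_pos hbc with ⟨hb, hc⟩ | ⟨hb, hc⟩
  · refine ⟨g, ?_⟩
    intro i j
    fin_cases i <;> fin_cases j
    · exact ⟨ha.le, ha'⟩
    · exact ⟨hb.le, by simp only [Fin.zero_eta, Fin.mk_one]; nlinarith⟩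
    · exact ⟨hc.le, by simp only [Fin.zero_eta, Fin.mk_one]; nlinarith⟩
    · exact ⟨hd.le, hd'⟩
  -- Conjugation by `S` swaps the diagonal entries and turns `(b, c)` into `(-c, -b)`.
  · refine ⟨ModularGroup.S * g, ?_⟩
    have e : ModularGroup.S * g * A * (ModularGroup.S * g)⁻¹ =
      ModularGroup.S * (g * A * g⁻¹) * ModularGroup.S⁻¹ := by group
    rw [e]
    generalize g * A * g⁻¹ = B at *
    have hconj := SL2_conj_coe B ModularGroup.S ModularGroup.coe_S
    rw [hconj]
    intro i j
    fin_cases i <;> fin_cases j <;> simp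
    · exact ⟨hd.le, hd'⟩
    · exact ⟨hc.le, by nlinarith⟩
    · exact ⟨hb.le, by nlinarith⟩
    · exact ⟨ha.le, ha'⟩

/-! ### The edge `{0, ∞}` separates the Farey graph -/

theorem extRat_one_zero : extRat 1 0 = (∞ : OnePoint ℚ) := by simp [extRat]

theorem extRat_eq_infty_of_den (p : ℤ) : extRat p 0 = (∞ : OnePoint ℚ) := by simp [extRat]

theorem extRat_zero_left {q : ℤ} (hq : q ≠ 0) : extRat 0 q = extRat 0 1 := by simp [extRat, hq]

/-- The extended rationals `p / q` with `0 ≤ p q`. -/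
def extNonneg : Set (OnePoint ℚ) :=
  {x | ∃ p q : ℤ, (p ≠ 0 ∨ q ≠ 0) ∧ x = extRat p q ∧ 0 ≤ p * q}

/-- The extended rationals `p / q` with `p q ≤ 0`. -/
def extNonpos : Set (OnePoint ℚ) :=
  {x | ∃ p q : ℤ, (p ≠ 0 ∨ q ≠ 0) ∧ x = extRat p q ∧ p * q ≤ 0}

/-- The sign of `p q` is independent of the fraction representing the vertex. -/
theorem mul_nonpos_of_extRat_mem {p q : ℤ} (h : extRat p q ∈ extNonpos) : p * q ≤ 0 := by
  obtain ⟨r, s, hrs, he, h⟩ := h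
  have h0 := extRat_det_eq_zero he
  have key : p * q * (s * s) = q * q * (r * s) := by linear_combination q * s * h0
  rcases eq_or_ne s 0 with rfl | hs
  · have hr : r ≠ 0 := by simpa using hrs
    have : q = 0 := by simpa [hr] using h0
    simp [this]
  · by_contra hc
    push Not at hc
    have h1 : 0 < p * q * (s * s) := mul_pos hc (mul_self_pos.mpr hs)
    nlinarith [mul_self_nonneg q]

theorem eq_zero_or_infty_of_mul_eq_zero {p q : ℤ} (h : p ≠ 0 ∨ q ≠ 0) (h0 : p * q = 0) :
    extRat p q = (∞ : OnePoint ℚ) ∨ extRat p q = extRat 0 1 := by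
  rcases mul_eq_zero.mp h0 with rfl | rfl
  · right; exact extRat_zero_left (by simpa using h)
  · left; exact extRat_eq_infty_of_den p

/-- A walk in the Farey graph from a nonpositive to a nonnegative vertex meets `{0, ∞}`. -/
theorem infty_or_zero_mem_support {u v : OnePoint ℚ} (w : fareyGraph.Walk u v)
    (hu : u ∈ extNonpos) (hv : v ∈ extNonneg) :
    (∞ : OnePoint ℚ) ∈ w.support ∨ extRat 0 1 ∈ w.support := by
  induction w with
  | nil =>
    obtain ⟨p, q, hpq, rfl, h⟩ := hv
    have := mul_nonpos_of_extRat_mem hu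
    rcases eq_zero_or_infty_of_mul_eq_zero hpq (le_antisymm this h) with h | h <;> simp [h]
  | cons hadj w ih =>
    have hadj' := hadj
    obtain ⟨p, q, r, s, rfl, rfl, h⟩ := hadj'
    have hpq := mul_nonpos_of_extRat_mem hu
    have h1 : p ≠ 0 ∨ q ≠ 0 := by
      by_contra hc
      push Not at hc
      simp [hc.1, hc.2] at h
    have h2 : r ≠ 0 ∨ s ≠ 0 := by
      by_contra hc
      push Not at hc
      simp [hc.1, hc.2] at h
    rcases hpq.eq_or_lt with h0 | h0
    · rcases eq_zero_or_infty_of_mul_eq_zero h1 h0 with h | h <;> simp [h]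
    by_cases hrs : r * s ≤ 0
    · rcases ih ⟨r, s, h2, rfl, hrs⟩ hv with h | h
      · left; simp [h]
      · right; simp [h]
    · exfalso
      push Not at hrs
      -- An edge cannot jump across: `p s` and `q r` have opposite signs, so `|p s - q r| ≥ 2`.
      have hneg : (p * s) * (q * r) < 0 := by nlinarith [mul_neg_of_neg_of_pos h0 hrs]
      rcases mul_neg_iff.mp hneg with ⟨ha, hb⟩ | ⟨ha, hb⟩
      · rw [abs_of_pos (by omega)] at h; omega
      · rw [abs_of_neg (by omega)] at h; omega

/-- The edge `{0, ∞}` of the Farey graph; `true` stands for `∞`. -/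
def baseEdge (b : Bool) : OnePoint ℚ := if b then ∞ else extRat 0 1

theorem baseEdge_mem_extNonneg (b : Bool) : baseEdge b ∈ extNonneg := by
  cases b
  · exact ⟨0, 1, by simp, rfl, by simp⟩
  · exact ⟨1, 0, by simp, extRat_one_zero.symm, by simp⟩

theorem baseEdge_mem_extNonpos (b : Bool) : baseEdge b ∈ extNonpos := by
  cases b
  · exact ⟨0, 1, by simp, rfl, by simp⟩
  · exact ⟨1, 0, by simp, extRat_one_zero.symm, by simp⟩

/-- Any path between the two sides can be cut at an end of the separating edge. -/
theorem edist_eq_iInf_baseEdge {u v : OnePoint ℚ} (hu : u ∈ extNonpos) (hv : v ∈ extNonneg) :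
    fareyGraph.edist u v =
      ⨅ b, (fareyGraph.edist u (baseEdge b) + fareyGraph.edist (baseEdge b) v) := by
  classical
  refine le_antisymm (le_iInf fun b ↦ SimpleGraph.edist_triangle) (le_iInf fun w ↦ ?_)
  have split : ∀ b, baseEdge b ∈ w.support →
      ⨅ b, (fareyGraph.edist u (baseEdge b) + fareyGraph.edist (baseEdge b) v) ≤ w.length := by
    intro b hb
    refine (iInf_le _ b).trans ?_
    rw [← w.take_spec hb, SimpleGraph.Walk.length_append, Nat.cast_add]
    exact add_le_add (SimpleGraph.edist_le _) (SimpleGraph.edist_le _)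
  rcases infty_or_zero_mem_support w hu hv with h | h
  · exact split true h
  · exact split false h

theorem mobiusSL_mem_extNonneg {B : SL(2, ℤ)} (hB : ∀ i j, 0 ≤ B i j) {x : OnePoint ℚ}
    (hx : x ∈ extNonneg) : mobiusSL B x ∈ extNonneg := by
  obtain ⟨p, q, hpq, rfl, h⟩ := hx
  rw [extRat_smul B hpq]
  have hdet := B.det_coe
  rw [Matrix.det_fin_two] at hdet
  refine ⟨_, _, ?_, rfl, ?_⟩
  · by_contra hc
    push Not at hc
    have e1 : p = 0 := by linear_combination B 1 1 * hc.1 - B 0 1 * hc.2 - p * hdet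
    have e2 : q = 0 := by linear_combination B 0 0 * hc.2 - B 1 0 * hc.1 - q * hdet
    simp [e1, e2] at hpq
  · have := hB 0 0
    have := hB 0 1
    have := hB 1 0
    have := hB 1 1
    have e : (B 0 0 * p + B 0 1 * q) * (B 1 0 * p + B 1 1 * q) =
      B 0 0 * B 1 0 * (p * p) + B 0 1 * B 1 1 * (q * q) +
        (B 0 0 * B 1 1 + B 0 1 * B 1 0) * (p * q) := by ring
    rw [e]
    have := mul_self_nonneg p
    have := mul_self_nonneg q
    positivity

/-- The inverse has nonnegative diagonal and nonpositive off-diagonal entries, so it keeps the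
nonpositive side; thus backward iterates of `∞` and forward images of `{0, ∞}` lie on opposite
sides. -/
theorem mobiusSL_inv_mem_extNonpos {B : SL(2, ℤ)} (hB : ∀ i j, 0 ≤ B i j) {x : OnePoint ℚ}
    (hx : x ∈ extNonpos) : mobiusSL B⁻¹ x ∈ extNonpos := by
  obtain ⟨p, q, hpq, rfl, h⟩ := hx
  rw [extRat_smul _ hpq, Matrix.SpecialLinearGroup.coe_inv, Matrix.adjugate_fin_two]
  have hdet := B.det_coe
  rw [Matrix.det_fin_two] at hdet
  refine ⟨_, _, ?_, rfl, ?_⟩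
  · by_contra hc
    push Not at hc
    simp at hc
    have e1 : p = 0 := by linear_combination B 0 0 * hc.1 + B 0 1 * hc.2 - p * hdet
    have e2 : q = 0 := by linear_combination B 1 1 * hc.2 + B 1 0 * hc.1 - q * hdet
    simp [e1, e2] at hpq
  · have := hB 0 0
    have := hB 0 1
    have := hB 1 0
    have := hB 1 1
    simp only [Matrix.of_apply, Matrix.cons_val', Matrix.cons_val_zero, Matrix.cons_val_one,
      Matrix.cons_val_fin_one]
    have e : (B 1 1 * p + -B 0 1 * q) * (-B 1 0 * p + B 0 0 * q) =
      -(B 1 1 * B 1 0 * (p * p) + B 0 1 * B 0 0 * (q * q) +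
        (B 0 0 * B 1 1 + B 0 1 * B 1 0) * (-(p * q))) := by ring
    rw [e]
    have := mul_self_nonneg p
    have := mul_self_nonneg q
    have := neg_nonneg.mpr h
    have : 0 ≤ B 1 1 * B 1 0 * (p * p) + B 0 1 * B 0 0 * (q * q) +
        (B 0 0 * B 1 1 + B 0 1 * B 1 0) * (-(p * q)) := by positivity
    linarith

/-! ### Translation length through min-plus products -/

/-- The row vectors `v₀, v₀ M, v₀ M², …` of min-plus algebra, where `v₀` lists the distances of
`∞` to the two ends of `baseEdge`. -/
noncomputable def minPlusOrbit (M : Bool → Bool → ℕ∞) : ℕ → Bool → ℕ∞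
  | 0, b => fareyGraph.edist ∞ (baseEdge b)
  | j + 1, b => ⨅ a, (minPlusOrbit M j a + M a b)

/-- The distances between `baseEdge` and its image. -/
noncomputable def edgeDist (f : PSL(2, ℤ)) (a b : Bool) : ℕ∞ :=
  fareyGraph.edist (baseEdge a) (mobius f (baseEdge b))

/-- Translating by `B ^ (-j)` puts `∞` on the nonpositive side and the next image of the edge on the
nonnegative side, so the distance splits at `{0, ∞}`: one min-plus multiplication. -/
theorem edist_mobius_pow_eq_minPlusOrbit {B : SL(2, ℤ)} (hB : ∀ i j, 0 ≤ B i j) (j : ℕ)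
    (b : Bool) : fareyGraph.edist ∞ (mobius ((B : PSL(2, ℤ)) ^ j) (baseEdge b)) =
      minPlusOrbit (edgeDist B) j b := by
  induction j generalizing b with
  | zero => simp [minPlusOrbit]
  | succ j ih =>
    have hneg : ∀ j : ℕ, mobius (((B : PSL(2, ℤ)) ^ j)⁻¹) ∞ ∈ extNonpos := by
      intro j
      induction j with
      | zero => simpa [baseEdge] using baseEdge_mem_extNonpos true
      | succ j ih =>
        rw [pow_succ, mul_inv_rev, map_mul, Equiv.Perm.mul_apply]
        exact mobiusSL_inv_mem_extNonpos hB ih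
    have hpos : mobius (B : PSL(2, ℤ)) (baseEdge b) ∈ extNonneg :=
      mobiusSL_mem_extNonneg hB (baseEdge_mem_extNonneg b)
    have shift : ∀ x, fareyGraph.edist ∞ (mobius ((B : PSL(2, ℤ)) ^ j) x) =
        fareyGraph.edist (mobius (((B : PSL(2, ℤ)) ^ j)⁻¹) ∞) x := by
      intro x
      rw [← edist_mobius (((B : PSL(2, ℤ)) ^ j)⁻¹), ← Equiv.Perm.mul_apply, ← map_mul]
      simp
    rw [pow_succ, map_mul, Equiv.Perm.mul_apply, shift, edist_eq_iInf_baseEdge (hneg j) hpos]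
    simp only [minPlusOrbit, ← ih, shift, edgeDist]

/-- The translation length of a nonnegative matrix is a function of the four distances between
the edge `{0, ∞}` and its image. -/
theorem translationLength_eq_liminf {B : SL(2, ℤ)} (hB : ∀ i j, 0 ≤ B i j) :
    translationLength (B : PSL(2, ℤ)) =
      liminf (fun j : ℕ ↦ (minPlusOrbit (edgeDist B) j true : ℝ≥0∞) / (j : ℝ≥0∞)) atTop := by
  unfold translationLength stableLengthAt
  congr 1
  ext j
  rw [← edist_mobius_pow_eq_minPlusOrbit hB]
  rfl

/-! ### Logarithmic bounds on distances -/

theorem extRat_adj_infty (p : ℤ) : fareyGraph.Adj ∞ (extRat p 1) :=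
  ⟨1, 0, p, 1, extRat_one_zero.symm, rfl, by simp⟩

/-- The Euclidean algorithm bounds the distance of `p / q` to `∞` logarithmically. -/
theorem edist_infty_extRat_le (n : ℕ) (p q : ℤ) (h : p ≠ 0 ∨ q ≠ 0) (hq : q.natAbs < 2 ^ n) :
    fareyGraph.edist ∞ (extRat p q) ≤ n := by
  induction n generalizing p q with
  | zero =>
    have : q = 0 := by simpa using hq
    simp [this, extRat]
  | succ n ih =>
    rcases eq_or_ne q 0 with rfl | hq0
    · simp [extRat]
    -- Division to the nearest integer: the remainder is at most `|q| / 2`, so each step removes a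
    -- binary digit.
    obtain ⟨m, hm⟩ : ∃ m : ℤ, (p - m * q).natAbs < 2 ^ n := by
      have hpos : 0 < q.natAbs := Int.natAbs_pos.mpr hq0
      have h1 := Int.bmod_lt (x := p) hpos
      have h2 := Int.le_bmod (x := p) hpos
      have h3 := Int.bmod_eq_self_sub_bdiv_mul p q.natAbs
      obtain ⟨m, hm⟩ : ∃ m : ℤ, p - m * q = p.bmod q.natAbs := by
        rcases Int.natAbs_eq q with h | h
        · exact ⟨p.bdiv q.natAbs, by rw [h3, ← h]⟩
        · refine ⟨-p.bdiv q.natAbs, ?_⟩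
          rw [h3]
          have : (q.natAbs : ℤ) = -q := by omega
          rw [this]; ring
      refine ⟨m, ?_⟩
      rw [hm]
      rw [pow_succ] at hq
      omega
    -- This isometry sends `m` to `∞` and makes the remainder the new denominator.
    let g : SL(2, ℤ) := ⟨!![0, -1; 1, -m], by simp⟩
    have e1 : mobiusSL g (extRat p q) = extRat (-q) (p - m * q) := by
      rw [extRat_smul g h]
      congr 1 <;> simp [g]
      ring
    have e2 : mobiusSL g (extRat m 1) = (∞ : OnePoint ℚ) := by
      rw [extRat_smul g (by simp), ← extRat_one_zero]
      simp [g, extRat]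
    have e3 : fareyGraph.edist (extRat m 1) (extRat p q) ≤ n := by
      rw [← edist_mobius (g : PSL(2, ℤ))]
      change fareyGraph.edist (mobiusSL g _) (mobiusSL g _) ≤ _
      rw [e1, e2]
      exact ih _ _ (Or.inl (by simpa using hq0)) hm
    calc fareyGraph.edist ∞ (extRat p q)
        ≤ fareyGraph.edist ∞ (extRat m 1) + fareyGraph.edist (extRat m 1) (extRat p q) :=
          SimpleGraph.edist_triangle
      _ ≤ 1 + n := add_le_add
          (SimpleGraph.edist_le_one_iff_adj_or_eq.mpr (Or.inl (extRat_adj_infty m))) e3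
      _ = ((n + 1 : ℕ) : ℕ∞) := by push_cast; ring

/-- The images of `0` and `∞` have entries of `B` as denominators; the extra `1` pays for moving
from `0` to `∞`. -/
theorem edgeDist_le {B : SL(2, ℤ)} {n : ℕ} (hB : ∀ i j, 0 ≤ B i j) (hn : ∀ i j, B i j < 2 ^ n)
    (a b : Bool) : edgeDist B a b ≤ (n + 1 : ℕ) := by
  have hdet := B.det_coe
  rw [Matrix.det_fin_two] at hdet
  have hn' : ∀ i j, (B i j).natAbs < 2 ^ n := by
    intro i j
    have h1 := hB i j
    have h2 := hn i j
    zify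
    rwa [abs_of_nonneg h1]
  have h1 : fareyGraph.edist ∞ (mobius (B : PSL(2, ℤ)) (baseEdge b)) ≤ n := by
    change fareyGraph.edist ∞ (mobiusSL B (baseEdge b)) ≤ n
    cases b
    · change fareyGraph.edist ∞ (mobiusSL B (extRat 0 1)) ≤ n
      rw [extRat_smul B (by simp)]
      refine edist_infty_extRat_le n _ _ ?_ (by simpa using hn' 1 1)
      by_contra hc
      push Not at hc
      simp at hc
      simp [hc] at hdet
    · change fareyGraph.edist ∞ (mobiusSL B ∞) ≤ n
      rw [← extRat_one_zero, extRat_smul B (by simp), extRat_one_zero]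
      refine edist_infty_extRat_le n _ _ ?_ (by simpa using hn' 1 0)
      by_contra hc
      push Not at hc
      simp at hc
      simp [hc] at hdet
  have h2 : fareyGraph.edist (baseEdge a) ∞ ≤ 1 := by
    cases a
    · exact SimpleGraph.edist_le_one_iff_adj_or_eq.mpr (Or.inl (extRat_adj_infty 0).symm)
    · simp [baseEdge]
  calc edgeDist B a b ≤ _ := SimpleGraph.edist_triangle (v := (∞ : OnePoint ℚ))
    _ ≤ 1 + n := add_le_add h2 h1
    _ = ((n + 1 : ℕ) : ℕ∞) := by push_cast; ring

/-! ### Dilatation, trace and conjugation -/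

theorem mem_spectrum_SL2_iff (A : SL(2, ℤ)) (μ : ℂ) :
    μ ∈ spectrum ℂ ((A : Matrix (Fin 2) (Fin 2) ℤ).map (Int.cast : ℤ → ℂ)) ↔
      μ ^ 2 - ((A : Matrix (Fin 2) (Fin 2) ℤ).trace : ℂ) * μ + 1 = 0 := by
  have hdet := SL2_det_entries A
  have hdet' : (A 0 0 : ℂ) * A 1 1 - A 0 1 * A 1 0 = 1 := by exact_mod_cast hdet
  rw [Matrix.mem_spectrum_iff_isRoot_charpoly, Matrix.charpoly_fin_two, Matrix.det_fin_two,
    Matrix.trace_fin_two, Matrix.trace_fin_two]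
  simp [hdet']

theorem dilatation_mk (A : SL(2, ℤ)) : dilatation (A : PSL(2, ℤ)) = (spectralRadius ℂ
    ((A : Matrix (Fin 2) (Fin 2) ℤ).map (Int.cast : ℤ → ℂ))).toReal := rfl

theorem absTrace_mk (A : SL(2, ℤ)) :
    absTrace (A : PSL(2, ℤ)) = |(A : Matrix (Fin 2) (Fin 2) ℤ).trace| := rfl

/-- With trace `t`, the eigenvalues are `μ` and `t - μ`, so the triangle inequality gives the first
bound; `μ² = t μ - 1` gives the second. -/
theorem dilatation_bounds (f : PSL(2, ℤ)) :
    (absTrace f : ℝ) ≤ 2 * dilatation f ∧ dilatation f ≤ absTrace f + 1 := by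
  obtain ⟨A, rfl⟩ := QuotientGroup.mk_surjective f
  rw [dilatation_mk, absTrace_mk]
  set M := (A : Matrix (Fin 2) (Fin 2) ℤ).map (Int.cast : ℤ → ℂ) with hM
  set t := (A : Matrix (Fin 2) (Fin 2) ℤ).trace with ht
  have hspec := mem_spectrum_SL2_iff A
  rw [← hM, ← ht] at hspec
  have hnorm : ‖(t : ℂ)‖ = |(t : ℝ)| := by simp
  have hle : ∀ μ ∈ spectrum ℂ M, ‖μ‖ ≤ |(t : ℝ)| + 1 := by
    intro μ hμ
    have h1 : μ ^ 2 = t * μ - 1 := by linear_combination (hspec μ).mp hμ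
    have h2 : ‖μ‖ ^ 2 ≤ |(t : ℝ)| * ‖μ‖ + 1 := by
      rw [← norm_pow, h1]
      refine (norm_sub_le _ _).trans ?_
      rw [norm_mul, hnorm, norm_one]
    by_contra hc
    push Not at hc
    nlinarith [abs_nonneg (t : ℝ), norm_nonneg μ]
  have hsup : spectralRadius ℂ M ≤ ENNReal.ofReal (|(t : ℝ)| + 1) := by
    refine iSup₂_le fun μ hμ ↦ ?_
    rw [← enorm_eq_nnnorm, ← ofReal_norm]
    exact ENNReal.ofReal_le_ofReal (hle μ hμ)
  have htop : spectralRadius ℂ M ≠ ⊤ := ne_top_of_le_ne_top ENNReal.ofReal_ne_top hsup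
  push_cast
  constructor
  · have hge : ∀ μ ∈ spectrum ℂ M, ‖μ‖ ≤ (spectralRadius ℂ M).toReal := by
      intro μ hμ
      rw [← ENNReal.ofReal_le_iff_le_toReal htop, ofReal_norm]
      exact le_iSup₂_of_le (f := fun μ (_ : μ ∈ spectrum ℂ M) ↦ (‖μ‖₊ : ℝ≥0∞)) μ hμ le_rfl
    obtain ⟨μ, hμ⟩ := spectrum.nonempty_of_isAlgClosed_of_finiteDimensional ℂ M
    have hμ' : (t : ℂ) - μ ∈ spectrum ℂ M := by
      rw [hspec] at hμ ⊢
      linear_combination hμ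
    have h1 := hge _ hμ
    have h2 := hge _ hμ'
    have h3 : ‖(t : ℂ)‖ ≤ ‖μ‖ + ‖(t : ℂ) - μ‖ := by
      simpa using norm_add_le μ ((t : ℂ) - μ)
    rw [hnorm] at h3
    linarith
  · exact ENNReal.toReal_le_of_le_ofReal (by positivity) hsup

theorem absTrace_conj (g f : PSL(2, ℤ)) : absTrace (g * f * g⁻¹) = absTrace f := by
  obtain ⟨A, rfl⟩ := QuotientGroup.mk_surjective f
  obtain ⟨h, rfl⟩ := QuotientGroup.mk_surjective g
  change |((h * A * h⁻¹ : SL(2, ℤ)) : Matrix (Fin 2) (Fin 2) ℤ).trace| = |_|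
  rw [Matrix.trace_fin_two, SL2_trace_conj, Matrix.trace_fin_two]

/-- Measuring the conjugate from the vertex `g ∞` cancels `g`. -/
theorem translationLength_conj (g f : PSL(2, ℤ)) :
    translationLength (g * f * g⁻¹) = translationLength f := by
  rw [← stableLengthAt_eq_translationLength (g * f * g⁻¹) (mobius g ∞)]
  unfold translationLength stableLengthAt
  congr 1
  ext j
  rw [conj_pow, ← Equiv.Perm.mul_apply, ← map_mul, inv_mul_cancel_right, map_mul,
    Equiv.Perm.mul_apply, edist_mobius]

/-- Of the two lifts `±A`, the one of positive trace is reduced. -/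
theorem IsHyperbolicPSL.exists_conj_entries_nonneg {f : PSL(2, ℤ)} (hf : IsHyperbolicPSL f) :
    ∃ B : SL(2, ℤ), ConjClasses.mk f = ConjClasses.mk (B : PSL(2, ℤ)) ∧
      translationLength (B : PSL(2, ℤ)) = translationLength f ∧
      ∀ i j, 0 ≤ B i j ∧ B i j ≤ absTrace f ^ 2 := by
  obtain ⟨A, htr, rfl⟩ : ∃ A : SL(2, ℤ), A 0 0 + A 1 1 = absTrace f ∧ (A : PSL(2, ℤ)) = f := by
    obtain ⟨A, rfl⟩ := QuotientGroup.mk_surjective f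
    rcases abs_cases (A : Matrix (Fin 2) (Fin 2) ℤ).trace with ⟨h, _⟩ | ⟨h, _⟩
    · exact ⟨A, by rw [absTrace_mk, h, Matrix.trace_fin_two], rfl⟩
    · refine ⟨-A, ?_, ?_⟩
      · rw [absTrace_mk, h, Matrix.trace_fin_two]
        simp
        ring
      · rw [QuotientGroup.eq]
        have : (-A)⁻¹ * A = -1 := by
          rw [inv_mul_eq_iff_eq_mul]
          simp
        rw [this, Subgroup.mem_center_iff]
        intro g
        simp
  have ht : 2 < A 0 0 + A 1 1 := by rw [htr]; exact hf
  obtain ⟨g, hg⟩ := _root_.exists_conj_entries_nonneg A ht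
  refine ⟨g * A * g⁻¹, ?_, translationLength_conj (g : PSL(2, ℤ)) A, by rwa [← htr]⟩
  exact ConjClasses.mk_eq_mk_iff_isConj.mpr (isConj_iff.mpr ⟨(g : PSL(2, ℤ)), rfl⟩)

theorem IsHyperbolicPSL.absTrace_sq_le {f : PSL(2, ℤ)} (hf : IsHyperbolicPSL f) {R : ℝ}
    (hR : dilatation f < R) : (absTrace f : ℝ) ^ 2 ≤ 4 * R ^ 2 := by
  have h1 := (dilatation_bounds f).1
  have h2 : (2 : ℝ) < absTrace f := by exact_mod_cast hf
  nlinarith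

/-! ### Counting classes and lengths -/

theorem hyperbolicClasses_finite (R : ℝ) : (hyperbolicClasses R).Finite := by
  have hfin : {B : SL(2, ℤ) | (fun i j ↦ B i j) ∈
      Set.Icc (0 : Fin 2 → Fin 2 → ℤ) (fun _ _ ↦ ⌈4 * R ^ 2⌉)}.Finite :=
    (Set.finite_Icc _ _).preimage (Subtype.val_injective.injOn (s := _))
  refine (hfin.image fun B : SL(2, ℤ) ↦ ConjClasses.mk (B : PSL(2, ℤ))).subset ?_
  rintro c ⟨f, rfl, hf, hR⟩
  obtain ⟨B, hc, -, hB⟩ := hf.exists_conj_entries_nonneg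
  refine ⟨B, ⟨fun i j ↦ (hB i j).1, fun i j ↦ (hB i j).2.trans ?_⟩, hc.symm⟩
  have h := (hf.absTrace_sq_le hR).trans (Int.le_ceil _)
  exact_mod_cast h

/-- The translation lengths of the hyperbolic elements with dilatation less than `R`. -/
def hyperbolicLengths (R : ℝ) : Set ℝ≥0∞ :=
  {l | ∃ f : PSL(2, ℤ), IsHyperbolicPSL f ∧ dilatation f < R ∧ translationLength f = l}

theorem hyperbolicLengths_finite_and_ncard_le {R : ℝ} {n : ℕ} (hn : 4 * R ^ 2 < 2 ^ n) :
    (hyperbolicLengths R).Finite ∧ (hyperbolicLengths R).ncard ≤ (n + 2) ^ 4 := by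
  -- Lengths are values of `Φ` on the four edge distances, each lying in `{0, …, n + 1}`.
  let Φ : (Bool → Bool → Fin (n + 2)) → ℝ≥0∞ := fun M ↦
    liminf (fun j : ℕ ↦ (minPlusOrbit (fun a b ↦ ((M a b : ℕ) : ℕ∞)) j true : ℝ≥0∞) /
      (j : ℝ≥0∞)) atTop
  have hsub : hyperbolicLengths R ⊆ Φ '' Set.univ := by
    rintro l ⟨f, hf, hR, rfl⟩
    obtain ⟨B, -, hl, hB⟩ := hf.exists_conj_entries_nonneg
    have hB2 : ∀ i j, B i j < 2 ^ n := by
      intro i j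
      have h1 : ((B i j : ℤ) : ℝ) ≤ (absTrace f : ℝ) ^ 2 := by exact_mod_cast (hB i j).2
      have h2 := (h1.trans (hf.absTrace_sq_le hR)).trans_lt hn
      exact_mod_cast h2
    have hd := edgeDist_le (fun i j ↦ (hB i j).1) hB2
    have hlt : ∀ a b, (edgeDist B a b).toNat < n + 2 := by
      intro a b
      have := ENat.toNat_le_of_le_natCast (hd a b)
      omega
    refine ⟨fun a b ↦ ⟨(edgeDist B a b).toNat, hlt a b⟩, trivial, ?_⟩
    rw [← hl, translationLength_eq_liminf fun i j ↦ (hB i j).1]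
    have : (fun a b ↦ (((edgeDist B a b).toNat : ℕ) : ℕ∞)) = edgeDist B := by
      ext1 a
      ext1 b
      exact ENat.natCast_toNat (ne_top_of_le_ne_top (ENat.natCast_ne_top _) (hd a b))
    simp only [Φ, this]
  have hfin : (Φ '' Set.univ).Finite := Set.finite_univ.image Φ
  refine ⟨hfin.subset hsub, (Set.ncard_le_ncard hsub hfin).trans
    ((Set.ncard_image_le Set.finite_univ).trans ?_)⟩
  rw [Set.ncard_univ, Nat.card_eq_fintype_card]
  simp only [Fintype.card_fun, Fintype.card_bool, Fintype.card_fin]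
  exact le_of_eq (by ring)

/-- Companion matrices of trace `t` are pairwise nonconjugate, and those with `3 ≤ t < R - 1`
qualify because the dilatation is at most `t + 1`. -/
theorem sub_four_le_ncard_hyperbolicClasses (R : ℝ) : R - 4 ≤ (hyperbolicClasses R).ncard := by
  let A : ℕ → SL(2, ℤ) := fun t ↦ ⟨!![t, -1; 1, 0], by simp⟩
  have htr : ∀ t, absTrace (A t : PSL(2, ℤ)) = t := by
    intro t
    rw [absTrace_mk, Matrix.trace_fin_two]
    simp [A]
  have hcard : (Finset.Ico 3 ⌈R - 1⌉₊).card ≤ (hyperbolicClasses_finite R).toFinset.card := by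
    refine Finset.card_le_card_of_injOn (fun t ↦ ConjClasses.mk (A t : PSL(2, ℤ))) ?_ ?_
    · intro t ht
      have ht' := Finset.mem_Ico.mp ht
      rw [Set.Finite.coe_toFinset]
      refine ⟨_, rfl, ?_, ?_⟩
      · change 2 < absTrace _
        rw [htr]
        omega
      · have h1 := (dilatation_bounds (A t)).2
        rw [htr] at h1
        have h2 := Nat.lt_ceil.mp ht'.2
        push_cast at h1
        linarith
    · intro s _ t _ h
      obtain ⟨g, hg⟩ := isConj_iff.mp (ConjClasses.mk_eq_mk_iff_isConj.mp h)
      have := absTrace_conj g (A s)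
      rw [hg, htr, htr] at this
      exact_mod_cast this.symm
  rw [← Set.ncard_eq_toFinset_card _ (hyperbolicClasses_finite R), Nat.card_Ico] at hcard
  have h1 : (⌈R - 1⌉₊ : ℝ) ≤ (hyperbolicClasses R).ncard + 3 := by
    exact_mod_cast (show ⌈R - 1⌉₊ ≤ (hyperbolicClasses R).ncard + 3 by omega)
  have h2 := Nat.le_ceil (R - 1)
  linarith

/-- Classes sharing their length with few others are at most `k` times as many as the lengths. -/
theorem ncard_diff_sameLengthCountBelow_le (k : ℕ) {R : ℝ} (hfin : (hyperbolicLengths R).Finite) :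
    (hyperbolicClasses R \ {c : ConjClasses PSL(2, ℤ) | ∃ f : PSL(2, ℤ), c = ConjClasses.mk f ∧
      IsHyperbolicPSL f ∧ dilatation f < R ∧ (k : ℕ∞) ≤ sameLengthCountBelow R f}).ncard ≤
      k * (hyperbolicLengths R).ncard := by
  classical
  set D := hyperbolicClasses R \ {c : ConjClasses PSL(2, ℤ) | ∃ f : PSL(2, ℤ),
    c = ConjClasses.mk f ∧ IsHyperbolicPSL f ∧ dilatation f < R ∧
      (k : ℕ∞) ≤ sameLengthCountBelow R f} with hD
  have hDfin : D.Finite := (hyperbolicClasses_finite R).sdiff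
  have hrep : ∀ c : ConjClasses PSL(2, ℤ), ∃ f : PSL(2, ℤ), c ∈ hyperbolicClasses R →
      c = ConjClasses.mk f ∧ IsHyperbolicPSL f ∧ dilatation f < R := by
    intro c
    by_cases hc : c ∈ hyperbolicClasses R
    · obtain ⟨f, hf⟩ := hc
      exact ⟨f, fun _ ↦ hf⟩
    · exact ⟨1, fun h ↦ absurd h hc⟩
  choose rep hrep using hrep
  rw [Set.ncard_eq_toFinset_card _ hDfin, Set.ncard_eq_toFinset_card _ hfin]
  refine Finset.card_le_mul_card_image_of_maps_to (f := fun c ↦ translationLength (rep c)) ?_ k ?_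
  · intro c hc
    rw [Set.Finite.mem_toFinset] at hc ⊢
    obtain ⟨-, h1, h2⟩ := hrep c hc.1
    exact ⟨_, h1, h2, rfl⟩
  · intro l _
    rcases Finset.eq_empty_or_nonempty
      {c ∈ hDfin.toFinset | translationLength (rep c) = l} with h | ⟨c, hc⟩
    · simp [h]
    rw [Finset.mem_filter, Set.Finite.mem_toFinset] at hc
    obtain ⟨h0, h1, h2⟩ := hrep c hc.1.1
    have hlt : sameLengthCountBelow R (rep c) < k := by
      by_contra hcon
      exact hc.1.2 ⟨_, h0, h1, h2, not_lt.mp hcon⟩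
    -- The fibre over `l` consists of classes counted by `sameLengthCountBelow` for any one of its
    -- members.
    have hle : (({c ∈ hDfin.toFinset | translationLength (rep c) = l} : Finset _).card : ℕ∞) ≤
        sameLengthCountBelow R (rep c) := by
      rw [← Set.encard_coe_eq_coe_finsetCard]
      refine Set.encard_le_encard fun c' hc' ↦ ?_
      rw [Finset.mem_coe, Finset.mem_filter, Set.Finite.mem_toFinset] at hc'
      obtain ⟨h0', h1', h2'⟩ := hrep c' hc'.1.1
      exact ⟨_, h0', h1', h2', hc'.2.trans hc.2.symm⟩
    exact_mod_cast (hle.trans hlt.le)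

theorem ncard_hyperbolicLengths_le_log {R : ℝ} (hR : 3 ≤ R) :
    (hyperbolicLengths R).Finite ∧ ((hyperbolicLengths R).ncard : ℝ) ≤ 4096 * Real.log R ^ 4 := by
  have hlog : 1 ≤ Real.log R := by
    rw [Real.le_log_iff_exp_le (by linarith)]
    exact Real.exp_one_lt_three.le.trans hR
  have hl2 := Real.log_two_gt_d9
  set x := 2 * Real.log R / Real.log 2 with hx
  have hx' : x * Real.log 2 = 2 * Real.log R := div_mul_cancel₀ _ (by linarith)
  have hx3 : x ≤ 3 * Real.log R := by
    rw [hx, div_le_iff₀ (by linarith)]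
    nlinarith
  have hx0 : 0 ≤ x := by positivity
  -- Since `x = 2 log₂ R`, `4 R ^ 2 = 2 ^ (x + 2)`, and the floor costs one more.
  have hn : 4 * R ^ 2 < 2 ^ (⌊x⌋₊ + 3) := by
    rw [Real.lt_pow_iff_log_lt (by positivity) (by norm_num),
      Real.log_mul (by norm_num) (by positivity), Real.log_pow,
      show (4 : ℝ) = 2 ^ 2 by norm_num, Real.log_pow]
    have := Nat.lt_floor_add_one x
    push_cast
    nlinarith
  obtain ⟨h1, h2⟩ := hyperbolicLengths_finite_and_ncard_le hn
  refine ⟨h1, ?_⟩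
  calc ((hyperbolicLengths R).ncard : ℝ) ≤ ((⌊x⌋₊ + 3 + 2 : ℕ) : ℝ) ^ 4 := by exact_mod_cast h2
    -- `⌊x⌋₊ + 5 ≤ 3 log R + 5 ≤ 8 log R`, as `log R ≥ 1`.
    _ ≤ (8 * Real.log R) ^ 4 := by
        have := Nat.floor_le hx0
        gcongr
        push_cast
        linarith
    _ = _ := by ring

/-- Stated for any family `G` between the classes with many companions below `R` and all classes, so
that it serves both limits. -/
theorem tendsto_ncard_div_hyperbolicClasses (k : ℕ) (G : ℝ → Set (ConjClasses PSL(2, ℤ)))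
    (hG : ∀ R, G R ⊆ hyperbolicClasses R)
    (hk : ∀ R, {c : ConjClasses PSL(2, ℤ) | ∃ f : PSL(2, ℤ), c = ConjClasses.mk f ∧
      IsHyperbolicPSL f ∧ dilatation f < R ∧ (k : ℕ∞) ≤ sameLengthCountBelow R f} ⊆ G R) :
    Tendsto (fun R : ℝ ↦ ((G R).ncard : ℝ) / ((hyperbolicClasses R).ncard : ℝ)) atTop (𝓝 1) := by
  have hlim : Tendsto (fun R : ℝ ↦ 1 - 8192 * k * (Real.log R ^ 4 / R)) atTop (𝓝 1) := by
    have h := (Real.isLittleO_pow_log_id_atTop (n := 4)).tendsto_div_nhds_zero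
    simpa using (h.const_mul (8192 * (k : ℝ))).const_sub 1
  refine tendsto_of_tendsto_of_tendsto_of_le_of_le' hlim tendsto_const_nhds ?_ ?_
  -- For `R ≥ 8` the class count is at least `R - 4 ≥ R / 2`, whence `8192 = 2 * 4096`.
  · filter_upwards [eventually_ge_atTop (8 : ℝ)] with R hR
    obtain ⟨h1, h2⟩ := ncard_hyperbolicLengths_le_log (by linarith : (3 : ℝ) ≤ R)
    have h3 := ncard_diff_sameLengthCountBelow_le k h1
    have h4 : (hyperbolicClasses R \ G R).ncard ≤ k * (hyperbolicLengths R).ncard :=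
      (Set.ncard_le_ncard (Set.sdiff_subset_sdiff_right (hk R))
        (hyperbolicClasses_finite R).sdiff).trans h3
    have h5 := Set.ncard_sdiff_add_ncard_of_subset (hG R) (hyperbolicClasses_finite R)
    have h6 : R / 2 ≤ (hyperbolicClasses R).ncard :=
      le_trans (by linarith) (sub_four_le_ncard_hyperbolicClasses R)
    have h7 : ((hyperbolicClasses R \ G R).ncard : ℝ) ≤ k * (4096 * Real.log R ^ 4) :=
      le_trans (by exact_mod_cast h4) (mul_le_mul_of_nonneg_left h2 (Nat.cast_nonneg k))
    have h8 : ((hyperbolicClasses R \ G R).ncard : ℝ) + (G R).ncard =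
        (hyperbolicClasses R).ncard := by exact_mod_cast h5
    have h9 : 0 < ((hyperbolicClasses R).ncard : ℝ) := by linarith
    rw [le_div_iff₀ h9]
    have h10 : k * (4096 * Real.log R ^ 4) ≤
        8192 * k * (Real.log R ^ 4 / R) * (hyperbolicClasses R).ncard := by
      calc k * (4096 * Real.log R ^ 4) = 8192 * k * (Real.log R ^ 4 / R) * (R / 2) := by
            field_simp
            ring
        _ ≤ _ := by
            have : 0 ≤ R := by linarith
            gcongr
    linarith
  · filter_upwards with R
    refine div_le_one_of_le₀ ?_ (Nat.cast_nonneg _)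
    exact_mod_cast Set.ncard_le_ncard (hG R) (hyperbolicClasses_finite R)

theorem sameLengthCountBelow_le (R : ℝ) (f : PSL(2, ℤ)) :
    sameLengthCountBelow R f ≤ sameLengthCount f :=
  Set.encard_le_encard fun _ ⟨f', h1, h2, _, h3⟩ ↦ ⟨f', h1, h2, h3⟩

theorem theorem5 (k : ℕ) (hk : 0 < k) :
    (∀ R : ℝ, (hyperbolicClasses R).Finite) ∧
    Tendsto (fun R : ℝ ↦
      (Set.ncard {c : ConjClasses PSL(2, ℤ) | ∃ f : PSL(2, ℤ), c = ConjClasses.mk f ∧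
        IsHyperbolicPSL f ∧ dilatation f < R ∧ (k : ℕ∞) ≤ sameLengthCount f} : ℝ) /
      (Set.ncard (hyperbolicClasses R) : ℝ)) atTop (𝓝 1) ∧
    Tendsto (fun R : ℝ ↦
      (Set.ncard {c : ConjClasses PSL(2, ℤ) | ∃ f : PSL(2, ℤ), c = ConjClasses.mk f ∧
        IsHyperbolicPSL f ∧ dilatation f < R ∧ (k : ℕ∞) ≤ sameLengthCountBelow R f} : ℝ) /
      (Set.ncard (hyperbolicClasses R) : ℝ)) atTop (𝓝 1) := by
  refine ⟨hyperbolicClasses_finite, ?_, ?_⟩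
  · exact tendsto_ncard_div_hyperbolicClasses k _
      (fun R c ⟨f, h1, h2, h3, _⟩ ↦ ⟨f, h1, h2, h3⟩)
      (fun R c ⟨f, h1, h2, h3, h4⟩ ↦ ⟨f, h1, h2, h3, h4.trans (sameLengthCountBelow_le R f)⟩)
  · exact tendsto_ncard_div_hyperbolicClasses k _
      (fun R c ⟨f, h1, h2, h3, _⟩ ↦ ⟨f, h1, h2, h3⟩) (fun R ↦ subset_rfl)
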